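/- Let $K$ be a field, $n\ge 0$, $R=K[x_1,\dots,x_n]$ with $x_1<\dots<x_n$, and let $\mathfrak j\subseteq R$ be a strongly stable ideal: a monomial ideal such that whenever $x^\beta\in\mathfrak j$ is a monomial, $i<j$ and $x_i\mid x^\beta$, also $x_jx^\beta/x_i\in\mathfrak j$. Let $m$ be a positive integer. Let $B_{\mathfrak j}$ be the minimal monomial generating set of $\mathfrak j$ and $\mathcal N(\mathfrak j)$ the set of monomials not in $\mathfrak j$. Let $C$ be the finite set of new variables $C_{\alpha\gamma}$, for $x^\alpha\in B_{\mathfrak j}$ and $x^\gamma\in\mathcal N(\mathfrak j)$ with $|\gamma|\le\max\{|\alpha|,m\}$, and let $$\mathfrak G=\Big\{\mathfrak f_\alpha=x^\alpha-\sum_{\gamma}C_{\alpha\gamma}x^\gamma \;:\; x^\alpha\in B_{\mathfrak j}\Big\}\subset K[C][x_1,\dots,x_n]$$ be the universal $[\mathfrak j,m]$-marked set. A polynomial in $K[C][x_1,\dots,x_n]$ is called reduced if no monomial of its support lies in $\mathfrak j$. Every monomial $x^\gamma\in\mathfrak j$ has a unique decomposition $x^\gamma=x^\alpha x^\eta$ with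 $x^\alpha\in B_{\mathfrak j}$ and every variable dividing $x^\eta$ less than or equal to every variable dividing $x^\alpha$; a step of the $\mathfrak G_*$-reduction replaces a polynomial $\mathfrak g$ by $\mathfrak g-c\,x^\eta\mathfrak f_\alpha$, where $x^\gamma\in\mathfrak j$ is a monomial of the support of $\mathfrak g$ with coefficient $c$, and the $\mathfrak G_*$-reduction is the composition of finitely many (possibly no) such steps. Let $\mathfrak A\subseteq K[C]$ be the ideal generated by - the coefficients of the monomials of degree $>m$ in the reduced polynomials obtained by $\mathfrak G_*$-reduction from the monomials $x^\beta\in\mathfrak j\setminus B_{\mathfrak j}$ with $|\beta|\le m$, and - the coefficients of all the reduced polynomials in the ideal $(\mathfrak G)\subseteq K[C][x_1,\dots,x_n]$. The $[\mathfrak j,m]$-marked family $\mathcal{M}\mathrm f(\mathfrak j,m)$ is the affine scheme $\operatorname{Spec}(K[C]/\mathfrak A)$ together with the universal family $$\pi:\operatorname{Spec}\big(K[C][x_1,\dots,x_n]/(\mathfrak A,\mathfrak G)\big)\longrightarrow\operatorname{Spec}(K[C]/\mathfrak A).$$ **Theorem.** The ideal $(C)/\mathfrak A$ is a point $o$ of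 $\operatorname{Spec}(K[C]/\mathfrak A)$, the origin, and it corresponds to $\mathfrak j$: the ideal $(\mathfrak G)$ specializes to $\mathfrak j$ at $C=0$. The family $\pi$ is flat at the origin, that is, for every point $x$ with $\pi(x)=o$ the local ring at $x$ is flat over the local ring of $\operatorname{Spec}(K[C]/\mathfrak A)$ at $o$. -/

import Mathlib

noncomputable section

namespace MarkedScheme

open MvPolynomial

/-! Exponents `α : Fin n →₀ ℕ` encode monomials `x^α` of `R = K[x_1, …, x_n]`; the element `i` of
`Fin n` is the variable `x_{i+1}`, and the variables are ordered as `x_1 < x_2 < ⋯ < x_n`, that is,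
by the order of `Fin n`. -/

/-- `x^β` is obtained from `x^α` through an increasing elementary move:
`x^α x_j = x^β x_i` for some `i < j`. -/
def IncreasingMove {n : ℕ} (α β : Fin n →₀ ℕ) : Prop :=
  ∃ i j : Fin n, i < j ∧ α + Finsupp.single j 1 = β + Finsupp.single i 1

/-- The Borel partial order: `BorelGT β α` means `x^β >_B x^α`, the transitive closure of the
relation given by increasing elementary moves. -/
def BorelGT {n : ℕ} (β α : Fin n →₀ ℕ) : Prop :=
  Relation.TransGen IncreasingMove α β

section Ideals

variable {K : Type*} [Field K] {n : ℕ}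

/-- A strongly stable ideal of `K[x_1, …, x_n]`: a monomial ideal that contains every monomial
`x^α` with `x^α >_B x^β` for some monomial `x^β` of the ideal. -/
structure IsStronglyStable (𝔧 : Ideal (MvPolynomial (Fin n) K)) : Prop where
  isMonomial : ∃ S : Set (Fin n →₀ ℕ), 𝔧 = Ideal.span ((fun α => monomial α (1 : K)) '' S)
  borel_closed : ∀ α β : Fin n →₀ ℕ, BorelGT α β →
    monomial β (1 : K) ∈ 𝔧 → monomial α (1 : K) ∈ 𝔧

/-- (The exponents of) the monomials that belong to `𝔧`. -/
def monomialsOf (𝔧 : Ideal (MvPolynomial (Fin n) K)) : Set (Fin n →₀ ℕ) :=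
  {γ | monomial γ (1 : K) ∈ 𝔧}

/-- The monomial basis `B_𝔧` of a monomial ideal: its minimal monomials with respect to
divisibility (for exponents, the componentwise order). -/
def monomialBasis (𝔧 : Ideal (MvPolynomial (Fin n) K)) : Set (Fin n →₀ ℕ) :=
  {α | Minimal (· ∈ monomialsOf 𝔧) α}

/-- The sous-escalier `𝒩(𝔧)`: the monomials that do not belong to `𝔧`. -/
def sousEscalier (𝔧 : Ideal (MvPolynomial (Fin n) K)) : Set (Fin n →₀ ℕ) :=
  (monomialsOf 𝔧)ᶜ

/-- `x^γ = x^α *_𝔧 x^η`: `γ = α + η` with `x^α ∈ B_𝔧` and `min(x^α) ≥ max(x^η)`. -/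
def IsStarDecomposition (𝔧 : Ideal (MvPolynomial (Fin n) K)) (γ : Fin n →₀ ℕ)
    (α : monomialBasis 𝔧) (η : Fin n →₀ ℕ) : Prop :=
  γ = α.1 + η ∧ ∀ i ∈ α.1.support, ∀ k ∈ η.support, k ≤ i

/-! ### Reduction by a marked set with coefficients in a ring `A` -/

variable {A : Type*} [CommRing A]

/-- A polynomial is reduced if no monomial of its support belongs to `𝔧`. -/
def IsReduced (𝔧 : Ideal (MvPolynomial (Fin n) K)) (g : MvPolynomial (Fin n) A) : Prop :=
  ∀ γ ∈ g.support, γ ∈ sousEscalier 𝔧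

/-- One step of the `𝔊_*`-reduction, for `𝔊 = {f_α : x^α ∈ B_𝔧}`: for a monomial
`x^γ = x^α *_𝔧 x^η` of the support of `g`, lying in `𝔧` and with coefficient `c_γ` in `g`,
replace `g` by `g - c_γ x^η f_α`. -/
def ReductionStep (𝔧 : Ideal (MvPolynomial (Fin n) K))
    (f : monomialBasis 𝔧 → MvPolynomial (Fin n) A) (g g₁ : MvPolynomial (Fin n) A) : Prop :=
  ∃ (γ : Fin n →₀ ℕ) (α : monomialBasis 𝔧) (η : Fin n →₀ ℕ),
    γ ∈ g.support ∧ γ ∈ monomialsOf 𝔧 ∧ IsStarDecomposition 𝔧 γ α η ∧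
      g₁ = g - monomial η (coeff γ g) * f α

/-- The `𝔊_*`-reduction: finitely many (possibly no) reduction steps. -/
def ReducesTo (𝔧 : Ideal (MvPolynomial (Fin n) K))
    (f : monomialBasis 𝔧 → MvPolynomial (Fin n) A) (g g₁ : MvPolynomial (Fin n) A) : Prop :=
  Relation.ReflTransGen (ReductionStep 𝔧 f) g g₁

/-! ### The universal `[𝔧, m]`-marked set -/

/-- The set `𝒩(𝔧)_{≤ max(|α|, m)}` of the monomials allowed in the tail of `f_α`. -/
def tailMonomials (𝔧 : Ideal (MvPolynomial (Fin n) K)) (m : ℕ) (α : Fin n →₀ ℕ) :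
    Set (Fin n →₀ ℕ) :=
  {γ | γ ∈ sousEscalier 𝔧 ∧ γ.degree ≤ max α.degree m}

theorem tailMonomials_finite (𝔧 : Ideal (MvPolynomial (Fin n) K)) (m : ℕ) (α : Fin n →₀ ℕ) :
    (tailMonomials 𝔧 m α).Finite :=
  (Finsupp.finite_of_degree_le (max α.degree m)).subset fun _ h => h.2

instance (𝔧 : Ideal (MvPolynomial (Fin n) K)) (m : ℕ) (α : Fin n →₀ ℕ) :
    Fintype (tailMonomials 𝔧 m α) :=
  (tailMonomials_finite 𝔧 m α).fintype

/-- The index set of the parameters `C_{αγ}`, for `x^α ∈ B_𝔧` and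
`x^γ ∈ 𝒩(𝔧)_{≤ max(|α|, m)}`. -/
abbrev ParamIndex (𝔧 : Ideal (MvPolynomial (Fin n) K)) (m : ℕ) : Type :=
  Σ α : monomialBasis 𝔧, tailMonomials 𝔧 m α.1

/-- The ring `K[C]` of polynomials in the parameters `C_{αγ}`. -/
abbrev ParamRing (𝔧 : Ideal (MvPolynomial (Fin n) K)) (m : ℕ) : Type _ :=
  MvPolynomial (ParamIndex 𝔧 m) K

/-- The polynomials `f_α = x^α - ∑ C_{αγ} x^γ` of `K[C][x_1, …, x_n]`, for `x^α ∈ B_𝔧`, which form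
the universal `[𝔧, m]`-marked set `𝔊`. -/
def universalMarkedSet (𝔧 : Ideal (MvPolynomial (Fin n) K)) (m : ℕ) (α : monomialBasis 𝔧) :
    MvPolynomial (Fin n) (ParamRing 𝔧 m) :=
  monomial α.1 1 - ∑ γ : tailMonomials 𝔧 m α.1, monomial γ.1 (X ⟨α, γ⟩)

/-- The ideal `(𝔊)` of `K[C][x_1, …, x_n]`. -/
def universalIdeal (𝔧 : Ideal (MvPolynomial (Fin n) K)) (m : ℕ) :
    Ideal (MvPolynomial (Fin n) (ParamRing 𝔧 m)) :=
  Ideal.span (Set.range (universalMarkedSet 𝔧 m))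

/-! ### The marked scheme and its universal family -/

/-- `𝒟₁`: the coefficients of the monomials of degree `> m` in the reduced polynomials `g_β` with
`x^β →_{𝔊_*} g_β`, for all `x^β ∈ 𝔧_{≤ m} \ B_𝔧`. -/
def coeffSet₁ (𝔧 : Ideal (MvPolynomial (Fin n) K)) (m : ℕ) : Set (ParamRing 𝔧 m) :=
  {c | ∃ (β : Fin n →₀ ℕ) (g : MvPolynomial (Fin n) (ParamRing 𝔧 m)),
    β ∈ monomialsOf 𝔧 ∧ β.degree ≤ m ∧ β ∉ monomialBasis 𝔧 ∧
      ReducesTo 𝔧 (universalMarkedSet 𝔧 m) (monomial β 1) g ∧ IsReduced 𝔧 g ∧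
      ∃ γ ∈ g.support, m < γ.degree ∧ c = coeff γ g}

/-- `𝒟₂`: the coefficients of all the reduced polynomials in `(𝔊) ⊆ K[C][x_1, …, x_n]`. -/
def coeffSet₂ (𝔧 : Ideal (MvPolynomial (Fin n) K)) (m : ℕ) : Set (ParamRing 𝔧 m) :=
  {c | ∃ g ∈ universalIdeal 𝔧 m, IsReduced 𝔧 g ∧ ∃ γ ∈ g.support, c = coeff γ g}

/-- The ideal `𝔄 = (𝒟₁ ∪ 𝒟₂) ⊆ K[C]` that defines the scheme structure of `ℳf(𝔧, m)`. -/
def structureIdeal (𝔧 : Ideal (MvPolynomial (Fin n) K)) (m : ℕ) : Ideal (ParamRing 𝔧 m) :=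
  Ideal.span (coeffSet₁ 𝔧 m ∪ coeffSet₂ 𝔧 m)

/-- The coordinate ring `K[C]/𝔄` of the scheme `ℳf(𝔧, m)`. -/
abbrev BaseRing (𝔧 : Ideal (MvPolynomial (Fin n) K)) (m : ℕ) : Type _ :=
  ParamRing 𝔧 m ⧸ structureIdeal 𝔧 m

/-- The ideal `(𝔄, 𝔊)` of `K[C][x_1, …, x_n]`. -/
def familyIdeal (𝔧 : Ideal (MvPolynomial (Fin n) K)) (m : ℕ) :
    Ideal (MvPolynomial (Fin n) (ParamRing 𝔧 m)) :=
  (structureIdeal 𝔧 m).map C ⊔ universalIdeal 𝔧 m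

/-- The coordinate ring `K[C][x_1, …, x_n]/(𝔄, 𝔊)` of the total space of the family. -/
abbrev FamilyRing (𝔧 : Ideal (MvPolynomial (Fin n) K)) (m : ℕ) : Type _ :=
  MvPolynomial (Fin n) (ParamRing 𝔧 m) ⧸ familyIdeal 𝔧 m

/-- The ring map `K[C]/𝔄 → K[C][x_1, …, x_n]/(𝔄, 𝔊)` induced by `K[C] ⊆ K[C][x_1, …, x_n]`. -/
def familyRingHom (𝔧 : Ideal (MvPolynomial (Fin n) K)) (m : ℕ) :
    BaseRing 𝔧 m →+* FamilyRing 𝔧 m :=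
  Ideal.quotientMap (familyIdeal 𝔧 m) C (Ideal.map_le_iff_le_comap.mp le_sup_left)

/-- The ideal `(C)/𝔄` of `K[C]/𝔄`, the image of the ideal generated by all the parameters. -/
def originIdeal (𝔧 : Ideal (MvPolynomial (Fin n) K)) (m : ℕ) : Ideal (BaseRing 𝔧 m) :=
  (Ideal.span (Set.range (X : ParamIndex 𝔧 m → ParamRing 𝔧 m))).map
    (Ideal.Quotient.mk (structureIdeal 𝔧 m))

end Ideals

section Schemes

open AlgebraicGeometry CategoryTheory

/-- A morphism of schemes is flat at a point `x` of its source if the local ring at `x` is flat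
over the local ring at the image of `x`. -/
def IsFlatAt {X Y : Scheme} (f : X ⟶ Y) (x : X) : Prop :=
  (f.stalkMap x).hom.Flat

universe u

variable {K : Type u} [Field K] {n : ℕ}

/-- The scheme `ℳf(𝔧, m) = Spec (K[C]/𝔄)`. -/
def markedScheme (𝔧 : Ideal (MvPolynomial (Fin n) K)) (m : ℕ) : Scheme.{u} :=
  Spec (CommRingCat.of (BaseRing 𝔧 m))

/-- The total space `Spec (K[C][x_1, …, x_n]/(𝔄, 𝔊))` of the universal family. -/
def familySpace (𝔧 : Ideal (MvPolynomial (Fin n) K)) (m : ℕ) : Scheme.{u} :=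
  Spec (CommRingCat.of (FamilyRing 𝔧 m))

/-- The universal family
`Spec (K[C][x_1, …, x_n]/(𝔄, 𝔊)) → Spec (K[C]/𝔄) = ℳf(𝔧, m)`. -/
def universalFamily (𝔧 : Ideal (MvPolynomial (Fin n) K)) (m : ℕ) :
    familySpace 𝔧 m ⟶ markedScheme 𝔧 m :=
  Spec.map (CommRingCat.ofHom (familyRingHom 𝔧 m))

end Schemes

end MarkedScheme

end

namespace MarkedScheme

open MvPolynomial

/-! ### Strongly stable ideals and star decompositions -/

section Monomials

variable {K : Type*} [Field K] {n : ℕ} {𝔧 : Ideal (MvPolynomial (Fin n) K)}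

/-! The family is free over `K[C]/𝔄`, with basis the monomials outside `𝔧`, hence flat everywhere
and in particular over the origin. Spanning (`monomial_add_mem_sup`): rewriting `x^γ x^η = x^α *_𝔧
x^η'` by the tail of `f_α` gives multiples by `x^η'` of monomials outside `𝔧`, and
`IsStarDecomposition.toColex_lt` shows that the multiplier drops in a well-order. Degrees play no
role, so tails of larger degree than their head are harmless. Independence
(`coeff_mem_structureIdeal_of_mem_familyIdeal`): a reduced element of `(𝔄, 𝔊)` has coefficients in
`𝔄`. This needs only that `𝔄` contains `𝒟₂`. At `C = 0` the marked set becomes `B_𝔧`, and a reduced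
polynomial in `𝔧` is zero; so `𝔄 ⊆ (C)` and the origin exists. -/

theorem monomialsOf_mono {α γ : Fin n →₀ ℕ} (h : α ≤ γ) (hα : α ∈ monomialsOf 𝔧) :
    γ ∈ monomialsOf 𝔧 := by
  obtain ⟨δ, rfl⟩ := exists_add_of_le h
  have h1 : monomial (α + δ) (1 : K) = monomial α 1 * monomial δ 1 := by
    rw [monomial_mul, one_mul]
  change monomial (α + δ) (1 : K) ∈ 𝔧
  rw [h1]
  exact 𝔧.mul_mem_right _ hα

theorem exists_monomialBasis_le {γ : Fin n →₀ ℕ} (h : γ ∈ monomialsOf 𝔧) :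
    ∃ α : monomialBasis 𝔧, α.1 ≤ γ := by
  obtain ⟨α, hα, hmin⟩ := exists_minimal_le_of_wellFoundedLT (· ∈ monomialsOf 𝔧) γ h
  exact ⟨⟨α, hmin⟩, hα⟩

namespace IsStronglyStable

theorem mem_monomialsOf_of_mem (h𝔧 : IsStronglyStable 𝔧) {p : MvPolynomial (Fin n) K}
    (hp : p ∈ 𝔧) {γ : Fin n →₀ ℕ} (hγ : γ ∈ p.support) : γ ∈ monomialsOf 𝔧 := by
  obtain ⟨S, hS⟩ := h𝔧.isMonomial
  have hp' := hp
  rw [hS, mem_ideal_span_monomial_image] at hp'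
  obtain ⟨s, hs, hle⟩ := hp' γ hγ
  refine monomialsOf_mono hle ?_
  change monomial s (1 : K) ∈ 𝔧
  rw [hS]
  exact Ideal.subset_span ⟨s, hs, rfl⟩

theorem span_monomialBasis (h𝔧 : IsStronglyStable 𝔧) :
    Ideal.span (Set.range fun α : monomialBasis 𝔧 => monomial α.1 (1 : K)) = 𝔧 := by
  apply le_antisymm
  · rw [Ideal.span_le]
    rintro _ ⟨α, rfl⟩
    exact α.2.prop
  · intro p hp
    have h1 : (Set.range fun α : monomialBasis 𝔧 => monomial α.1 (1 : K)) =
        (fun α => monomial α (1 : K)) '' monomialBasis 𝔧 := by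
      ext; simp
    rw [h1, mem_ideal_span_monomial_image]
    intro γ hγ
    obtain ⟨α, hα⟩ := exists_monomialBasis_le (h𝔧.mem_monomialsOf_of_mem hp hγ)
    exact ⟨α.1, α.2, hα⟩

/-- A non-minimal monomial of `𝔧` stays in `𝔧` after division by its smallest variable. -/
theorem tsub_single_mem (h𝔧 : IsStronglyStable 𝔧) {γ : Fin n →₀ ℕ} (hγ : γ ∈ monomialsOf 𝔧)
    (hB : γ ∉ monomialBasis 𝔧) :
    ∃ k ∈ γ.support, (∀ i ∈ γ.support, k ≤ i) ∧ γ - Finsupp.single k 1 ∈ monomialsOf 𝔧 := by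
  obtain ⟨α, hα⟩ := exists_monomialBasis_le hγ
  have hne : α.1 ≠ γ := fun h => hB (h ▸ α.2)
  obtain ⟨i, hi⟩ : ∃ i, α.1 i < γ i := by
    by_contra! hcon
    exact hne (le_antisymm hα hcon)
  have hiγ : i ∈ γ.support := Finsupp.mem_support_iff.mpr (by omega)
  set k := γ.support.min' ⟨i, hiγ⟩ with hk
  have hkγ : k ∈ γ.support := Finset.min'_mem _ _
  have hkmin : ∀ j ∈ γ.support, k ≤ j := fun j hj => Finset.min'_le _ _ hj
  have hi' : γ - Finsupp.single i 1 ∈ monomialsOf 𝔧 := by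
    refine monomialsOf_mono (α := α.1) (fun j => ?_) α.2.prop
    have := hα j
    by_cases hij : i = j
    · subst hij; simp; omega
    · simpa [Finsupp.single_apply, hij] using this
  refine ⟨k, hkγ, hkmin, ?_⟩
  rcases (hkmin i hiγ).eq_or_lt with h | h
  · rwa [h]
  -- Dividing by `x_k` instead of `x_i`, with `k < i`, is an increasing elementary move.
  · refine h𝔧.borel_closed _ (γ - Finsupp.single i 1) (.single ⟨k, i, h, ?_⟩) hi'
    rw [tsub_add_cancel_of_le, tsub_add_cancel_of_le] <;>
      rw [Finsupp.single_le_iff, Nat.one_le_iff_ne_zero, ← Finsupp.mem_support_iff] <;> assumption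

/-- Strip the smallest variable repeatedly until a minimal generator remains; each stripped variable
is at most every variable still present. -/
theorem exists_isStarDecomposition (h𝔧 : IsStronglyStable 𝔧) (γ : Fin n →₀ ℕ)
    (hγ : γ ∈ monomialsOf 𝔧) : ∃ α η, IsStarDecomposition 𝔧 γ α η := by
  induction γ using WellFoundedLT.induction with
  | ind γ ih =>
    by_cases hB : γ ∈ monomialBasis 𝔧
    · exact ⟨⟨γ, hB⟩, 0, by simp, by simp⟩
    · obtain ⟨k, hkγ, hkmin, hmem⟩ := h𝔧.tsub_single_mem hγ hB
      have hle : Finsupp.single k 1 ≤ γ := by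
        rwa [Finsupp.single_le_iff, Nat.one_le_iff_ne_zero, ← Finsupp.mem_support_iff]
      have hadd := tsub_add_cancel_of_le hle
      have hlt : γ - Finsupp.single k 1 < γ := by
        refine lt_of_le_of_ne tsub_le_self fun h => ?_
        rw [h] at hadd
        simp at hadd
      obtain ⟨α, η, hdec, hvar⟩ := ih _ hlt hmem
      have hsum : γ = α.1 + (η + Finsupp.single k 1) := by
        rw [← add_assoc, ← hdec, hadd]
      refine ⟨α, η + Finsupp.single k 1, hsum, fun i hi j hj => ?_⟩
      rcases Finset.mem_union.mp (Finsupp.support_add hj) with h | h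
      · exact hvar i hi j h
      · have hjk : j = k := by simpa using Finsupp.support_single_subset h
        subst hjk
        refine hkmin i ?_
        rw [Finsupp.mem_support_iff] at hi ⊢
        rw [hsum, Finsupp.add_apply]
        omega

end IsStronglyStable

/-- If `x^γ ∉ 𝔧` and `x^γ x^η = x^α *_𝔧 x^η'`, then `x^η'` is lexicographically smaller than
`x^η`, the largest variable counting first. -/
theorem IsStarDecomposition.toColex_lt {γ η η' : Fin n →₀ ℕ} {α : monomialBasis 𝔧}
    (h : IsStarDecomposition 𝔧 (γ + η) α η') (hγ : γ ∉ monomialsOf 𝔧) :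
    toColex η' < toColex η := by
  obtain ⟨hsum, hvar⟩ := h
  have happ : ∀ j, γ j + η j = α.1 j + η' j := fun j => DFunLike.congr_fun hsum j
  by_contra hcon
  -- Otherwise `α ≤ γ`. At the largest index `i` where `η` and `η'` differ, `η' i > η i`, so `x_i`
  -- divides `x^η'` and `α` vanishes below `i`; above `i`, `α` and `γ` agree.
  refine hγ (monomialsOf_mono (α := α.1) (fun j => ?_) α.2.prop)
  rcases (not_lt.mp hcon).eq_or_lt with heq | hlt
  · have : η = η' := toColex.injective heq
    subst this
    have := happ j
    omega
  · obtain ⟨i, hi, hii⟩ := Finsupp.Colex.lt_iff.mp hlt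
    simp only [ofColex_toColex] at hi hii
    have h1 := happ j
    rcases lt_trichotomy j i with hj | rfl | hj
    · have : α.1 j = 0 := by
        by_contra hne
        have := hvar j (Finsupp.mem_support_iff.mpr hne) i
          (Finsupp.mem_support_iff.mpr (by omega))
        exact absurd hj (not_lt.mpr this)
      omega
    · omega
    · have := hi j hj
      omega

end Monomials

/-! ### Reduction modulo a marked set over any ring -/

section Reduction

variable {K : Type*} [Field K] {n : ℕ} {𝔧 : Ideal (MvPolynomial (Fin n) K)}
  {A : Type*} [CommRing A]

theorem isReduced_iff_mem_restrictSupport {g : MvPolynomial (Fin n) A} :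
    IsReduced 𝔧 g ↔ g ∈ restrictSupport A (sousEscalier 𝔧) :=
  Iff.rfl

theorem ReducesTo.sub_mem {f : monomialBasis 𝔧 → MvPolynomial (Fin n) A}
    {g g₁ : MvPolynomial (Fin n) A} (h : ReducesTo 𝔧 f g g₁) :
    g - g₁ ∈ Ideal.span (Set.range f) := by
  induction h with
  | refl => simp
  | @tail b c _ hs ih =>
    obtain ⟨γ, α, η, -, -, -, rfl⟩ := hs
    rw [← sub_add]
    exact add_mem ih (Ideal.mul_mem_left _ _ (Ideal.subset_span ⟨α, rfl⟩))

/-- Well-founded induction on the multiplier `η`, for all `γ` outside `𝔧` at once, since rewriting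
replaces `γ` by the various tail monomials. -/
theorem monomial_add_mem_sup (h𝔧 : IsStronglyStable 𝔧)
    {f : monomialBasis 𝔧 → MvPolynomial (Fin n) A}
    (hf : ∀ α, monomial α.1 1 - f α ∈ restrictSupport A (sousEscalier 𝔧))
    (η : Colex (Fin n →₀ ℕ)) : ∀ γ ∉ monomialsOf 𝔧,
      monomial (γ + ofColex η) (1 : A) ∈ restrictSupport A (sousEscalier 𝔧) ⊔
        (Ideal.span (Set.range f)).restrictScalars A := by
  have : WellFoundedLT (Colex (Fin n →₀ ℕ)) := Finsupp.Colex.wellFoundedLT_of_finite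
  induction η using WellFoundedLT.induction with
  | ind η ih =>
    intro γ hγ
    by_cases hmem : γ + ofColex η ∈ monomialsOf 𝔧
    · obtain ⟨α, η', hdec⟩ := h𝔧.exists_isStarDecomposition _ hmem
      have hlt : toColex η' < η := hdec.toColex_lt hγ
      have hsplit : monomial (γ + ofColex η) (1 : A) =
          (monomial α.1 1 - f α) * monomial η' 1 + f α * monomial η' 1 := by
        rw [← add_mul, sub_add_cancel, monomial_mul, one_mul, hdec.1]
      rw [hsplit]
      refine add_mem ?_ (Submodule.mem_sup_right
        (Ideal.mul_mem_right _ _ (Ideal.subset_span ⟨α, rfl⟩)))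
      have ht := hf α
      rw [mem_restrictSupport_iff] at ht
      rw [as_sum (monomial α.1 1 - f α), Finset.sum_mul]
      refine sum_mem fun δ hδ => ?_
      have h1 : monomial δ (coeff δ (monomial α.1 1 - f α)) * monomial η' (1 : A) =
          coeff δ (monomial α.1 1 - f α) • monomial (δ + η') (1 : A) := by
        rw [monomial_mul, smul_monomial, smul_eq_mul]
      rw [h1]
      exact Submodule.smul_mem _ _ (ih (toColex η') hlt δ (ht hδ))
    · exact Submodule.mem_sup_left ((monomial_mem_restrictSupport _).mpr (Or.inl hmem))

theorem monomial_mem_sup (h𝔧 : IsStronglyStable 𝔧)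
    {f : monomialBasis 𝔧 → MvPolynomial (Fin n) A}
    (hf : ∀ α, monomial α.1 1 - f α ∈ restrictSupport A (sousEscalier 𝔧)) (γ : Fin n →₀ ℕ) :
    monomial γ (1 : A) ∈ restrictSupport A (sousEscalier 𝔧) ⊔
        (Ideal.span (Set.range f)).restrictScalars A := by
  by_cases hγ : γ ∈ monomialsOf 𝔧
  -- If `1 ∈ 𝔧`, there are no reduced monomials, the tail is empty and the marked set contains `1`.
  -- Otherwise `γ` is a multiplier of `1 ∉ 𝔧`.
  · by_cases h0 : (0 : Fin n →₀ ℕ) ∈ monomialsOf 𝔧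
    · have hB : (0 : Fin n →₀ ℕ) ∈ monomialBasis 𝔧 := ⟨h0, fun _ _ _ => zero_le⟩
      have htail : monomial 0 1 - f ⟨0, hB⟩ = 0 := by
        have h1 := hf ⟨0, hB⟩
        rw [mem_restrictSupport_iff] at h1
        rw [← support_eq_empty, Finset.eq_empty_iff_forall_notMem]
        exact fun δ hδ => h1 hδ (monomialsOf_mono (zero_le) h0)
      have hone : (1 : MvPolynomial (Fin n) A) ∈ Ideal.span (Set.range f) :=
        Ideal.subset_span ⟨⟨0, hB⟩, (sub_eq_zero.mp htail).symm⟩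
      refine Submodule.mem_sup_right ?_
      rw [(Ideal.eq_top_iff_one _).mpr hone]
      trivial
    · simpa using monomial_add_mem_sup h𝔧 hf (toColex γ) 0 h0
  · exact Submodule.mem_sup_left ((monomial_mem_restrictSupport _).mpr (Or.inl hγ))

/-- Every polynomial with coefficients in `𝔞` is congruent modulo the marked set to a reduced
polynomial with coefficients in `𝔞`. -/
theorem exists_isReduced_sub_mem (h𝔧 : IsStronglyStable 𝔧)
    {f : monomialBasis 𝔧 → MvPolynomial (Fin n) A}
    (hf : ∀ α, monomial α.1 1 - f α ∈ restrictSupport A (sousEscalier 𝔧)) (𝔞 : Ideal A)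
    {p : MvPolynomial (Fin n) A} (hp : p ∈ 𝔞.map C) :
    ∃ r, IsReduced 𝔧 r ∧ r ∈ 𝔞.map C ∧ p - r ∈ Ideal.span (Set.range f) := by
  -- Reducing each monomial separately and scaling by its coefficient keeps all coefficients in `𝔞`.
  choose s hs t ht hst using fun γ => Submodule.mem_sup.mp (monomial_mem_sup h𝔧 hf γ)
  refine ⟨∑ γ ∈ p.support, coeff γ p • s γ, ?_, ?_, ?_⟩
  · rw [isReduced_iff_mem_restrictSupport]
    exact sum_mem fun γ _ => Submodule.smul_mem _ _ (hs γ)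
  · refine sum_mem fun γ _ => ?_
    rw [smul_eq_C_mul]
    exact Ideal.mul_mem_right _ _ (Ideal.mem_map_of_mem _ (mem_map_C_iff.mp hp γ))
  · have h1 : p - ∑ γ ∈ p.support, coeff γ p • s γ = ∑ γ ∈ p.support, C (coeff γ p) * t γ := by
      conv_lhs => enter [1]; rw [as_sum p]
      rw [← Finset.sum_sub_distrib]
      refine Finset.sum_congr rfl fun γ _ => ?_
      have h2 : monomial γ (coeff γ p) = coeff γ p • monomial γ (1 : A) := by
        rw [smul_monomial, smul_eq_mul, mul_one]
      rw [h2, ← hst γ, smul_add, add_sub_cancel_left, smul_eq_C_mul]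
    rw [h1]
    exact sum_mem fun γ _ => Ideal.mul_mem_left _ _ (ht γ)

end Reduction

/-! ### The origin and the freeness of the universal family -/

section Family

variable {K : Type*} [Field K] {n : ℕ} {𝔧 : Ideal (MvPolynomial (Fin n) K)} {m : ℕ}

theorem monomial_sub_universalMarkedSet_mem (α : monomialBasis 𝔧) :
    monomial α.1 1 - universalMarkedSet 𝔧 m α ∈
      restrictSupport (ParamRing 𝔧 m) (sousEscalier 𝔧) := by
  rw [universalMarkedSet, sub_sub_cancel]
  exact sum_mem fun γ _ => (monomial_mem_restrictSupport _).mpr (Or.inl γ.2.1)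

theorem map_constantCoeff_universalMarkedSet (α : monomialBasis 𝔧) :
    MvPolynomial.map (constantCoeff : ParamRing 𝔧 m →+* K) (universalMarkedSet 𝔧 m α) =
      monomial α.1 1 := by
  simp [universalMarkedSet, map_monomial]

/-- At `C = 0` the ideal `(𝔊)` specializes to `𝔧`. -/
theorem map_constantCoeff_universalIdeal (h𝔧 : IsStronglyStable 𝔧) :
    (universalIdeal 𝔧 m).map (MvPolynomial.map (constantCoeff : ParamRing 𝔧 m →+* K)) = 𝔧 := by
  rw [universalIdeal, Ideal.map_span, ← Set.range_comp]
  conv_rhs => rw [← h𝔧.span_monomialBasis]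
  congr 2
  funext α
  exact map_constantCoeff_universalMarkedSet α

theorem constantCoeff_coeff_eq_zero (h𝔧 : IsStronglyStable 𝔧)
    {g : MvPolynomial (Fin n) (ParamRing 𝔧 m)} (hg : IsReduced 𝔧 g)
    (hmem : MvPolynomial.map (constantCoeff : ParamRing 𝔧 m →+* K) g ∈ 𝔧) (γ : Fin n →₀ ℕ) :
    constantCoeff (coeff γ g) = 0 := by
  by_contra hne
  have hγ : γ ∈ g.support := mem_support_iff.mpr fun h => hne (by rw [h, map_zero])
  refine hg γ hγ (h𝔧.mem_monomialsOf_of_mem hmem ?_)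
  rwa [mem_support_iff, coeff_map]

/-- Both kinds of generators are coefficients of reduced polynomials specializing into `𝔧`: for
`𝒟₁`, `x^β - g_β ∈ (𝔊)` and `x^β ∈ 𝔧`. -/
theorem structureIdeal_le_ker (h𝔧 : IsStronglyStable 𝔧) :
    structureIdeal 𝔧 m ≤ RingHom.ker (constantCoeff : ParamRing 𝔧 m →+* K) := by
  have hI : ∀ g ∈ universalIdeal 𝔧 m,
      MvPolynomial.map (constantCoeff : ParamRing 𝔧 m →+* K) g ∈ 𝔧 := fun g hg => by
    have := Ideal.mem_map_of_mem (MvPolynomial.map (constantCoeff : ParamRing 𝔧 m →+* K)) hg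
    rwa [map_constantCoeff_universalIdeal h𝔧] at this
  rw [structureIdeal, Ideal.span_le]
  rintro _ (⟨β, g, hβ, -, -, hred, hg, γ, -, -, rfl⟩ | ⟨g, hgI, hg, γ, -, rfl⟩)
  · refine constantCoeff_coeff_eq_zero h𝔧 hg ?_ γ
    have h1 := hI _ hred.sub_mem
    rw [map_sub, map_monomial, map_one] at h1
    exact (Submodule.sub_mem_iff_right _ hβ).mp h1
  · exact constantCoeff_coeff_eq_zero h𝔧 hg (hI g hgI) γ

theorem span_range_X_eq_ker (σ R : Type*) [CommRing R] :
    Ideal.span (Set.range (X : σ → MvPolynomial σ R)) =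
      RingHom.ker (constantCoeff : MvPolynomial σ R →+* R) := by
  ext p
  rw [← Set.image_univ, mem_ideal_span_X_image, RingHom.mem_ker, constantCoeff_eq]
  refine ⟨fun h => ?_, fun h s hs => ?_⟩
  · by_contra hne
    obtain ⟨i, -, hi⟩ := h 0 (mem_support_iff.mpr hne)
    exact hi rfl
  · by_contra! hcon
    have h0 : s = 0 := by
      ext i
      exact hcon i trivial
    rw [mem_support_iff, h0] at hs
    exact hs h

theorem originIdeal_isPrime (h𝔧 : IsStronglyStable 𝔧) : (originIdeal 𝔧 m).IsPrime := by
  rw [originIdeal, span_range_X_eq_ker]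
  have := RingHom.ker_isPrime (constantCoeff : ParamRing 𝔧 m →+* K)
  refine Ideal.map_isPrime_of_surjective Ideal.Quotient.mk_surjective ?_
  rw [Ideal.mk_ker]
  exact structureIdeal_le_ker h𝔧

theorem coeff_mem_structureIdeal {g : MvPolynomial (Fin n) (ParamRing 𝔧 m)}
    (hg : IsReduced 𝔧 g) (hmem : g ∈ universalIdeal 𝔧 m) (γ : Fin n →₀ ℕ) :
    coeff γ g ∈ structureIdeal 𝔧 m := by
  by_cases h : γ ∈ g.support
  · exact Ideal.subset_span (Or.inr ⟨g, hmem, hg, γ, h, rfl⟩)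
  · rw [notMem_support_iff.mp h]
    exact zero_mem _

/-- Write `g = p + q` with `p` over `𝔄` and `q ∈ (𝔊)`, and reduce `p` to `r`, still over `𝔄`. Then
`g - r` is reduced and lies in `(𝔊)`, so its coefficients are in `𝔄` by `𝒟₂`. -/
theorem coeff_mem_structureIdeal_of_mem_familyIdeal (h𝔧 : IsStronglyStable 𝔧)
    {g : MvPolynomial (Fin n) (ParamRing 𝔧 m)} (hg : IsReduced 𝔧 g)
    (hmem : g ∈ familyIdeal 𝔧 m) (γ : Fin n →₀ ℕ) : coeff γ g ∈ structureIdeal 𝔧 m := by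
  obtain ⟨p, hp, q, hq, rfl⟩ := Submodule.mem_sup.mp hmem
  obtain ⟨r, hr, hrA, hpr⟩ := exists_isReduced_sub_mem h𝔧
    monomial_sub_universalMarkedSet_mem (structureIdeal 𝔧 m) hp
  have h1 : p + q - r ∈ universalIdeal 𝔧 m := by
    rw [add_sub_right_comm]
    exact add_mem hpr hq
  have h2 : IsReduced 𝔧 (p + q - r) := by
    rw [isReduced_iff_mem_restrictSupport] at hg hr ⊢
    exact sub_mem hg hr
  have h3 := add_mem (coeff_mem_structureIdeal h2 h1 γ) (mem_map_C_iff.mp hrA γ)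
  rwa [coeff_sub, sub_add_cancel] at h3

/-- The universal family is flat: the monomials of `𝒩(𝔧)` are a basis of its coordinate ring over
`K[C]/𝔄`. -/
theorem familyRingHom_flat (h𝔧 : IsStronglyStable 𝔧) :
    RingHom.Flat (R := BaseRing 𝔧 m) (S := FamilyRing 𝔧 m) (familyRingHom 𝔧 m) := by
  let : Algebra (BaseRing 𝔧 m) (FamilyRing 𝔧 m) :=
    RingHom.toAlgebra (R := BaseRing 𝔧 m) (S := FamilyRing 𝔧 m) (familyRingHom 𝔧 m)
  change Module.Flat (BaseRing 𝔧 m) (FamilyRing 𝔧 m)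
  let v : sousEscalier 𝔧 → FamilyRing 𝔧 m := fun γ =>
    Ideal.Quotient.mk (familyIdeal 𝔧 m) (monomial γ.1 1)
  have hsmul : ∀ (a : ParamRing 𝔧 m) (p : MvPolynomial (Fin n) (ParamRing 𝔧 m)),
      Ideal.Quotient.mk (structureIdeal 𝔧 m) a • Ideal.Quotient.mk (familyIdeal 𝔧 m) p =
        Ideal.Quotient.mk (familyIdeal 𝔧 m) (a • p) := fun a p => by
    rw [Algebra.smul_def, smul_eq_C_mul, map_mul]
    rfl
  have hli : LinearIndependent (BaseRing 𝔧 m) v := by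
    rw [linearIndependent_iff]
    intro l hl
    -- Lifting the coefficients of the relation to `K[C]` turns it into a reduced polynomial in `(𝔄,
    -- 𝔊)`.
    obtain ⟨l', rfl⟩ := Finsupp.mapRange_surjective (Ideal.Quotient.mk (structureIdeal 𝔧 m))
      (map_zero _) Ideal.Quotient.mk_surjective l
    let g : MvPolynomial (Fin n) (ParamRing 𝔧 m) := l'.sum fun γ a => monomial γ.1 a
    have hg : IsReduced 𝔧 g := by
      rw [isReduced_iff_mem_restrictSupport]
      exact sum_mem fun γ _ => (monomial_mem_restrictSupport _).mpr (Or.inl γ.2)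
    have hgI : g ∈ familyIdeal 𝔧 m := by
      rw [← Ideal.Quotient.eq_zero_iff_mem, ← hl, Finsupp.linearCombination_apply,
        Finsupp.sum_mapRange_index fun γ => zero_smul (BaseRing 𝔧 m) (v γ)]
      change Ideal.Quotient.mk _ (∑ γ ∈ l'.support, monomial γ.1 (l' γ)) = ∑ γ ∈ l'.support, _
      rw [map_sum]
      refine Finset.sum_congr rfl fun γ _ => ?_
      refine Eq.trans ?_ (hsmul _ _).symm
      rw [smul_monomial, smul_eq_mul, mul_one]
    ext γ
    rw [Finsupp.mapRange_apply, Finsupp.zero_apply, Ideal.Quotient.eq_zero_iff_mem]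
    have hcoeff : coeff γ.1 g = l' γ := by
      classical
      simp only [g, Finsupp.sum, coeff_sum, coeff_monomial, Subtype.val_inj]
      rw [Finset.sum_ite_eq', ite_eq_left_iff, eq_comm]
      exact Finsupp.notMem_support_iff.mp
    rw [← hcoeff]
    exact coeff_mem_structureIdeal_of_mem_familyIdeal h𝔧 hg hgI γ.1
  have hspan : ⊤ ≤ Submodule.span (BaseRing 𝔧 m) (Set.range v) := by
    rintro x -
    obtain ⟨p, rfl⟩ := Ideal.Quotient.mk_surjective x
    rw [as_sum p, map_sum]
    refine sum_mem fun δ _ => ?_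
    have h2 : monomial δ (coeff δ p) = coeff δ p • monomial δ (1 : ParamRing 𝔧 m) := by
      rw [smul_monomial, smul_eq_mul, mul_one]
    rw [h2, ← hsmul]
    refine Submodule.smul_mem _ _ ?_
    obtain ⟨s, hs, t, ht, hst⟩ := Submodule.mem_sup.mp
      (monomial_mem_sup h𝔧 (monomial_sub_universalMarkedSet_mem (m := m)) δ)
    have ht0 : Ideal.Quotient.mk (familyIdeal 𝔧 m) t = 0 :=
      Ideal.Quotient.eq_zero_iff_mem.mpr (Ideal.mem_sup_right ht)
    rw [← hst, map_add, ht0, add_zero, as_sum s, map_sum]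
    refine sum_mem fun γ hγ => ?_
    have h3 : monomial γ (coeff γ s) = coeff γ s • monomial γ (1 : ParamRing 𝔧 m) := by
      rw [smul_monomial, smul_eq_mul, mul_one]
    rw [h3, ← hsmul]
    exact Submodule.smul_mem _ _ (Submodule.subset_span ⟨⟨γ, hs hγ⟩, rfl⟩)
  have : Module.Free (BaseRing 𝔧 m) (FamilyRing 𝔧 m) := .of_basis (.mk hli hspan)
  infer_instance

open AlgebraicGeometry in
theorem universalFamily_flat (h𝔧 : IsStronglyStable 𝔧) : Flat (universalFamily 𝔧 m) :=
  Flat.SpecMap_iff.mpr (familyRingHom_flat h𝔧)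

end Family

end MarkedScheme

theorem mainTheorem4 {K : Type*} [Field K] {n : ℕ}
    (𝔧 : Ideal (MvPolynomial (Fin n) K)) (h𝔧 : MarkedScheme.IsStronglyStable 𝔧)
    (m : ℕ) (hm : 0 < m) :
    -- at `C = 0` the ideal `(𝔊)` specializes to `𝔧`,
    (MarkedScheme.universalIdeal 𝔧 m).map
        (MvPolynomial.map (MvPolynomial.constantCoeff :
          MarkedScheme.ParamRing 𝔧 m →+* K)) = 𝔧 ∧
      -- the origin is a point of the marked scheme,
      ∃ o : PrimeSpectrum (MarkedScheme.BaseRing 𝔧 m),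
        o.asIdeal = MarkedScheme.originIdeal 𝔧 m ∧
        -- and the universal family is flat there.
        ∀ x : MarkedScheme.familySpace 𝔧 m,
          MarkedScheme.universalFamily 𝔧 m x = o →
            MarkedScheme.IsFlatAt (MarkedScheme.universalFamily 𝔧 m) x := by
  refine ⟨MarkedScheme.map_constantCoeff_universalIdeal h𝔧,
    ⟨MarkedScheme.originIdeal 𝔧 m, MarkedScheme.originIdeal_isPrime h𝔧⟩, rfl, fun x _ => ?_⟩
  have := MarkedScheme.universalFamily_flat (m := m) h𝔧
  exact AlgebraicGeometry.Flat.stalkMap _ x
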